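/- Let $1\le d\le n-1$ and let $\mathbb P=P_{\binom n2-1}(\mathbb C)$ be the complex projective space with homogeneous coordinates $s_{ij}$, $1\le i<j\le n$; put $s_{ji}=s_{ij}$ and $s_{ii}=0$. For $k\ge 0$ let $CM^{k,n}(\mathbb C)\subset\mathbb P$ be the Zariski closure of the set of points $(|p_i-p_j|^2)_{i<j}$, where $(p_1,\dots,p_n)$ runs over the $n$-tuples of points of $\mathbb R^k$ that are not all equal (so $CM^{0,n}(\mathbb C)=\emptyset$). Fix an index $o\in\{1,\dots,n\}$ (for example $o=1$), and for $s\in\mathbb C^{\binom n2}$ let $A(s)$ be the symmetric $(n-1)\times(n-1)$ Gram matrix with entries $a_{ij}(s)=\tfrac12(s_{oi}+s_{oj}-s_{ij})$, $i,j\ne o$. The projective dual $X^*$ of a projective variety $X\subset\mathbb P$ is the Zariski closure, in the dual projective space $\mathbb P^*$, of the set of hyperplanes that contain the embedded projective tangent space of $X$ at some smooth point of $X$ (so the dual of $\mathbb P$ itself is empty). Then the projective dual of $CM^{d,n}(\mathbb C)$ is naturally identified with $CM^{n-d-1,n}(\mathbb C)$ via the trace pairing of symmetric matrices: the map sending $s$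 to the linear form $t\mapsto \mathrm{Tr}\,(A(s)A(t))$ is a linear isomorphism from $\mathbb C^{\binom n2}$ onto its dual space, and the induced projective isomorphism $\mathbb P\to\mathbb P^*$ maps $CM^{n-d-1,n}(\mathbb C)$ onto $CM^{d,n}(\mathbb C)^*$. -/

import Mathlib

open scoped LinearAlgebra.Projectivization Matrix

noncomputable section

namespace CayleyMenger

/-! ### Projective varieties in homogeneous coordinates -/

section Projective

variable {σ : Type*}

/-- A polynomial vanishes at a point of projective space. This is used for homogeneous polynomials
only, for which the choice of the representative is irrelevant. -/
def VanishesAt (f : MvPolynomial σ ℂ) (x : ℙ ℂ (σ → ℂ)) : Prop :=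
  MvPolynomial.eval x.rep f = 0

/-- The homogeneous polynomials (of any degree) that vanish at every point of `S`. -/
def homogeneousVanishing (S : Set (ℙ ℂ (σ → ℂ))) : Set (MvPolynomial σ ℂ) :=
  {f | (∃ k : ℕ, f.IsHomogeneous k) ∧ ∀ x ∈ S, VanishesAt f x}

/-- The Zariski closure of a subset of projective space: the common zero locus of all homogeneous
polynomials that vanish on the subset. -/
def zariskiClosure (S : Set (ℙ ℂ (σ → ℂ))) : Set (ℙ ℂ (σ → ℂ)) :=
  {x | ∀ f ∈ homogeneousVanishing S, VanishesAt f x}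

/-- The vector of partial derivatives of `f` at `v`. -/
def differentialAt (f : MvPolynomial σ ℂ) (v : σ → ℂ) : σ → ℂ :=
  fun i => MvPolynomial.eval v (MvPolynomial.pderiv i f)

/-- `x` is a smooth (nonsingular) point of the closed set `X`: on a Zariski open neighbourhood
`{g ≠ 0}` of `x`, the set `X` is cut out by finitely many homogeneous polynomials vanishing on `X`
whose differentials at `x` are linearly independent. -/
def IsSmoothPoint (X : Set (ℙ ℂ (σ → ℂ))) (x : ℙ ℂ (σ → ℂ)) : Prop :=
  x ∈ X ∧ ∃ (c : ℕ) (f : Fin c → MvPolynomial σ ℂ) (g : MvPolynomial σ ℂ),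
    (∀ i, f i ∈ homogeneousVanishing X) ∧
    LinearIndependent ℂ (fun i => differentialAt (f i) x.rep) ∧
    (∃ k : ℕ, g.IsHomogeneous k) ∧ ¬ VanishesAt g x ∧
    ∀ y, ¬ VanishesAt g y → (∀ i, VanishesAt (f i) y) → y ∈ X

variable [Fintype σ]

/-- The linear subspace of `σ → ℂ` whose projectivization is the embedded projective tangent
space of `X` at `x`: the vectors killed by the differentials at `x` of all homogeneous polynomials
vanishing on `X`. -/
def tangentSpace (X : Set (ℙ ℂ (σ → ℂ))) (x : ℙ ℂ (σ → ℂ)) : Submodule ℂ (σ → ℂ) where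
  carrier := {w | ∀ f ∈ homogeneousVanishing X, differentialAt f x.rep ⬝ᵥ w = 0}
  add_mem' := by
    intro a b ha hb f hf
    rw [dotProduct_add, ha f hf, hb f hf, add_zero]
  zero_mem' := by
    intro f _
    exact dotProduct_zero _
  smul_mem' := by
    intro c a ha f hf
    rw [dotProduct_smul, ha f hf, smul_zero]

/-- The projective dual of `X`, in the dual projective space with its dual homogeneous coordinates:
the point `h` stands for the hyperplane `{w | ∑ i, h i * w i = 0}`. It is the Zariski closure of
the set of hyperplanes that contain the projective tangent space of `X` at some smooth point. -/
def projectiveDual (X : Set (ℙ ℂ (σ → ℂ))) : Set (ℙ ℂ (σ → ℂ)) :=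
  zariskiClosure {h | ∃ x, IsSmoothPoint X x ∧ ∀ w ∈ tangentSpace X x, h.rep ⬝ᵥ w = 0}

end Projective

/-! ### Configurations and Cayley-Menger varieties -/

/-- The index set of the homogeneous Cayley coordinates `s i j`, `i < j`; it has `n.choose 2`
elements. -/
abbrev Pairs (n : ℕ) : Type := {q : Fin n × Fin n // q.1 < q.2}

/-- Configurations of `n` labeled points in Euclidean `d`-space, at least two of them distinct.
(Configurations that differ by a congruence and a rescaling have proportional squared distances,
so they define the same point of projective space below.) -/
abbrev Configuration (n d : ℕ) : Type :=
  {p : Fin n → EuclideanSpace ℝ (Fin d) // ∃ i j, p i ≠ p j}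

/-- The mutual squared distances of a configuration. -/
def squaredDistances {n d : ℕ} (p : Configuration n d) : Pairs n → ℂ :=
  fun q => ((‖p.1 q.1.1 - p.1 q.1.2‖ ^ 2 : ℝ) : ℂ)

theorem squaredDistances_ne_zero {n d : ℕ} (p : Configuration n d) : squaredDistances p ≠ 0 := by
  obtain ⟨p, i, j, hij⟩ := p
  intro h
  have key : ∀ a b : Fin n, a < b → p a = p b := by
    intro a b hab
    have h1 := congrFun h ⟨(a, b), hab⟩
    simpa [squaredDistances, sub_eq_zero] using h1
  rcases lt_trichotomy i j with hlt | heq | hgt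
  · exact hij (key i j hlt)
  · exact hij (congrArg p heq)
  · exact hij (key j i hgt).symm

/-- The point of complex projective space given by the mutual squared distances. -/
def distancePoint {n d : ℕ} (p : Configuration n d) : ℙ ℂ (Pairs n → ℂ) :=
  Projectivization.mk ℂ (squaredDistances p) (squaredDistances_ne_zero p)

/-- The complex Cayley-Menger variety `CM^{d,n}(ℂ)`. -/
def cayleyMenger (d n : ℕ) : Set (ℙ ℂ (Pairs n → ℂ)) :=
  zariskiClosure (Set.range (distancePoint (n := n) (d := d)))

/-! ### Gram coordinates -/

/-- The coordinates `s i j` for arbitrary `i`, `j`: symmetric, and zero for `i = j`. -/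
def cayleyEntry {n : ℕ} (s : Pairs n → ℂ) (i j : Fin n) : ℂ :=
  if h : i < j then s ⟨(i, j), h⟩ else if h : j < i then s ⟨(j, i), h⟩ else 0

/-- The Gram matrix, with the point labeled `o` as origin. It is symmetric of size `n - 1`. -/
def gramMatrix {n : ℕ} (o : Fin n) (s : Pairs n → ℂ) :
    Matrix {i : Fin n // i ≠ o} {i : Fin n // i ≠ o} ℂ :=
  Matrix.of fun i j =>
    (cayleyEntry s o i.1 + cayleyEntry s o j.1 - cayleyEntry s i.1 j.1) / 2

end CayleyMenger

end

/-! In Gram coordinates the statement is the classical duality of symmetric determinantal varieties.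
The Gram map identifies `Pairs n → ℂ` with the symmetric matrices of size `n - 1`
(`gramLinear_injective`, `exists_gramLinear_eq`), and `CM^{k,n}` becomes the locus of rank at most
`k` (`mk_mem_cayleyMenger_iff`): a complex symmetric matrix of rank at most `k` is some `P * Pᵀ`
with `k` columns, and real configurations are Zariski dense among complex ones.

At a point `P * Pᵀ` of rank exactly `d`, the curves `(P + tQ) * (P + tQ)ᵀ` show that a symmetric `B`
normal to the variety satisfies `B * P = 0`, so its rank is at most `n - 1 - d`; at smaller rank the
tangent space is everything and no hyperplane contains it (`rank_le_of_tangent`). Conversely, if `B`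
has rank at most `n - 1 - d`, diagonalizing `B` by a congruence yields a point of rank `d` supported
on indices where `B` vanishes. Bordered minors show that this point is smooth and bound its tangent
space from above, so `B` is normal there (`exists_smooth_tangent`). The tangent hyperplanes thus
already form a closed set. -/

namespace CayleyMenger

/-! ### Gram matrices -/

section Gram

variable {n : ℕ}

theorem cayleyEntry_of_symm (F : Fin n → Fin n → ℂ) (hF : ∀ i j, F i j = F j i)
    (h0 : ∀ i, F i i = 0) (i j : Fin n) :
    cayleyEntry (fun q : Pairs n => F q.1.1 q.1.2) i j = F i j := by
  unfold cayleyEntry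
  split_ifs with h1 h2
  · rfl
  · exact hF j i
  · rw [le_antisymm (not_lt.1 h2) (not_lt.1 h1), h0]

theorem cayleyEntry_self (s : Pairs n → ℂ) (i : Fin n) : cayleyEntry s i i = 0 := by
  simp [cayleyEntry]

theorem cayleyEntry_comm (s : Pairs n → ℂ) (i j : Fin n) :
    cayleyEntry s i j = cayleyEntry s j i := by
  unfold cayleyEntry
  rcases lt_trichotomy i j with h | h | h
  · simp [h, h.not_gt]
  · simp [h]
  · simp [h, h.not_gt]

theorem cayleyEntry_pair (s : Pairs n → ℂ) (q : Pairs n) : cayleyEntry s q.1.1 q.1.2 = s q := by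
  simp [cayleyEntry, q.2]

theorem cayleyEntry_add (s t : Pairs n → ℂ) (i j : Fin n) :
    cayleyEntry (s + t) i j = cayleyEntry s i j + cayleyEntry t i j := by
  unfold cayleyEntry
  split_ifs <;> simp

theorem cayleyEntry_smul (c : ℂ) (s : Pairs n → ℂ) (i j : Fin n) :
    cayleyEntry (c • s) i j = c * cayleyEntry s i j := by
  unfold cayleyEntry
  split_ifs <;> simp

/-- The Gram matrix as a linear map. -/
noncomputable def gramLinear (o : Fin n) :
    (Pairs n → ℂ) →ₗ[ℂ] Matrix {i : Fin n // i ≠ o} {i : Fin n // i ≠ o} ℂ where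
  toFun := gramMatrix o
  map_add' s t := by
    ext i j
    simp only [gramMatrix, Matrix.of_apply, Matrix.add_apply, cayleyEntry_add]
    ring
  map_smul' c s := by
    ext i j
    simp only [gramMatrix, Matrix.of_apply, Matrix.smul_apply, cayleyEntry_smul, smul_eq_mul,
      RingHom.id_apply]
    ring

theorem gramLinear_apply (o : Fin n) (s : Pairs n → ℂ) : gramLinear o s = gramMatrix o s := rfl

theorem gramLinear_transpose (o : Fin n) (s : Pairs n → ℂ) :
    (gramLinear o s)ᵀ = gramLinear o s := by
  ext i j
  simp only [gramLinear_apply, gramMatrix, Matrix.of_apply, Matrix.transpose_apply]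
  rw [cayleyEntry_comm s j.1 i.1]
  ring

/-- The diagonal entry at `i` is `s_{oi}`; once these are known, the entry at `(i, j)` determines
`s_{ij}`. -/
theorem gramLinear_injective (o : Fin n) : Function.Injective (gramLinear o) := by
  rw [← LinearMap.ker_eq_bot, LinearMap.ker_eq_bot']
  intro s hs
  have hG : ∀ i j : {i : Fin n // i ≠ o},
      (cayleyEntry s o i.1 + cayleyEntry s o j.1 - cayleyEntry s i.1 j.1) / 2 = 0 :=
    fun i j => congrFun (congrFun hs i) j
  have ho : ∀ i, cayleyEntry s o i = 0 := by
    intro i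
    by_cases hi : i = o
    · rw [hi, cayleyEntry_self]
    · have := hG ⟨i, hi⟩ ⟨i, hi⟩
      rw [cayleyEntry_self] at this
      linear_combination this
  funext q
  rw [Pi.zero_apply, ← cayleyEntry_pair s q]
  by_cases h1 : q.1.1 = o
  · rw [h1, ho]
  by_cases h2 : q.1.2 = o
  · rw [h2, cayleyEntry_comm, ho]
  have := hG ⟨_, h1⟩ ⟨_, h2⟩
  rw [ho, ho] at this
  linear_combination -2 * this

theorem exists_gramLinear_eq (o : Fin n)
    (M : Matrix {i : Fin n // i ≠ o} {i : Fin n // i ≠ o} ℂ) (hM : Mᵀ = M) :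
    ∃ s, gramLinear o s = M := by
  let m : Fin n → Fin n → ℂ := fun i j =>
    if h : i ≠ o ∧ j ≠ o then M ⟨i, h.1⟩ ⟨j, h.2⟩ else 0
  have hm : ∀ i j, m i j = m j i := by
    intro i j
    by_cases h : i ≠ o ∧ j ≠ o
    · simp only [m, dif_pos h, dif_pos h.symm]
      exact congrFun (congrFun hM ⟨j, h.2⟩) ⟨i, h.1⟩
    · simp only [m, dif_neg h, dif_neg (fun h' => h (And.symm h'))]
  -- The law of cosines, with `M` extended by zero to the row and column of the origin `o`.
  refine ⟨fun q => m q.1.1 q.1.1 + m q.1.2 q.1.2 - 2 * m q.1.1 q.1.2, ?_⟩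
  have key := cayleyEntry_of_symm (fun i j => m i i + m j j - 2 * m i j)
    (fun i j => by simp only [hm i j]; ring) (fun i => by ring)
  ext i j
  simp only [gramLinear_apply, gramMatrix, Matrix.of_apply, key]
  have ho : ∀ j, m o j = 0 := fun j => dif_neg (by simp)
  have hij : m i j = M i j := dif_pos ⟨i.2, j.2⟩
  rw [ho, ho, ho, hij]
  ring

/-- The squared distances of a complex configuration. -/
def complexSquaredDistances {k : ℕ} (p : Fin n × Fin k → ℂ) : Pairs n → ℂ :=
  fun q => ∑ l, (p (q.1.1, l) - p (q.1.2, l)) ^ 2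

theorem gramLinear_complexSquaredDistances {k : ℕ} (o : Fin n) (p : Fin n × Fin k → ℂ) :
    gramLinear o (complexSquaredDistances p) =
      (Matrix.of fun (i : {i : Fin n // i ≠ o}) l => p (i.1, l) - p (o, l)) *
        (Matrix.of fun (i : {i : Fin n // i ≠ o}) l => p (i.1, l) - p (o, l))ᵀ := by
  have key : ∀ i j, cayleyEntry (complexSquaredDistances p) i j =
      ∑ l, (p (i, l) - p (j, l)) ^ 2 :=
    cayleyEntry_of_symm (fun i j => ∑ l, (p (i, l) - p (j, l)) ^ 2)
      (fun i j => Finset.sum_congr rfl fun l _ => by ring) (fun i => by simp)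
  ext i j
  simp only [gramLinear_apply, gramMatrix, Matrix.of_apply, key,
    Matrix.mul_apply, Matrix.transpose_apply]
  rw [← Finset.sum_add_distrib, ← Finset.sum_sub_distrib, Finset.sum_div]
  exact Finset.sum_congr rfl fun l _ => by ring

theorem complexSquaredDistances_eq {k : ℕ} (o : Fin n)
    (P : Matrix {i : Fin n // i ≠ o} (Fin k) ℂ) (s : Pairs n → ℂ)
    (hs : gramLinear o s = P * Pᵀ) :
    ∃ p : Fin n × Fin k → ℂ, complexSquaredDistances p = s := by
  refine ⟨fun a => if h : a.1 ≠ o then P ⟨a.1, h⟩ a.2 else 0, gramLinear_injective o ?_⟩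
  rw [gramLinear_complexSquaredDistances, hs]
  have : (Matrix.of fun (i : {i : Fin n // i ≠ o}) (l : Fin k) =>
      (if h : i.1 ≠ o then P ⟨i.1, h⟩ l else 0) - (if h : o ≠ o then P ⟨o, h⟩ l else 0)) = P := by
    ext i l
    simp [i.2]
  simp only [this]

theorem squaredDistances_eq_complex {k : ℕ} (p : Configuration n k) :
    squaredDistances p = complexSquaredDistances (fun a => ((p.1 a.1 a.2 : ℝ) : ℂ)) := by
  funext q
  simp [squaredDistances, complexSquaredDistances, EuclideanSpace.norm_sq_eq]

/-- The conjugate of a symmetric matrix is again symmetric, hence a Gram matrix. Pairing with it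
gives the sum of the squared absolute values of the entries. -/
theorem trace_gramLinear_injective (o : Fin n) (s : Pairs n → ℂ)
    (h : ∀ t, (gramLinear o s * gramLinear o t).trace = 0) : s = 0 := by
  obtain ⟨t, ht⟩ := exists_gramLinear_eq o (gramLinear o s)ᴴ (by
    ext i j
    exact congrArg star (congrFun (congrFun (gramLinear_transpose o s) j) i))
  have h1 := h t
  open scoped ComplexOrder in
  rw [ht, Matrix.trace_mul_conjTranspose_self_eq_zero_iff] at h1
  exact gramLinear_injective o (by rw [h1, map_zero])

/-- The trace pairing, as an isomorphism of the space of Cayley coordinates with its dual. -/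
theorem exists_tracePairing (o : Fin n) :
    ∃ e : (Pairs n → ℂ) ≃ₗ[ℂ] (Pairs n → ℂ), ∀ s t,
      e s ⬝ᵥ t = (gramLinear o s * gramLinear o t).trace := by
  let f : (Pairs n → ℂ) →ₗ[ℂ] (Pairs n → ℂ) := LinearMap.pi fun q =>
    Matrix.traceLinearMap _ ℂ ℂ ∘ₗ
      LinearMap.mulRight ℂ (gramLinear o (Pi.single q 1)) ∘ₗ gramLinear o
  have hf : ∀ s t, f s ⬝ᵥ t = (gramLinear o s * gramLinear o t).trace := by
    intro s t
    conv_rhs => rw [pi_eq_sum_univ' t]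
    simp [f, dotProduct, Finset.mul_sum, Matrix.trace_sum, mul_comm]
  have hinj : Function.Injective f := by
    rw [← LinearMap.ker_eq_bot, LinearMap.ker_eq_bot']
    intro s hs
    exact trace_gramLinear_injective o s fun t => by rw [← hf, hs, zero_dotProduct]
  exact ⟨LinearEquiv.ofInjectiveEndo f hinj, fun s t => by
    rw [← hf]; rfl⟩

end Gram

/-! ### Polynomials -/

section Polynomials

variable {σ : Type*}

theorem eval_smul_of_isHomogeneous {f : MvPolynomial σ ℂ} {k : ℕ} (hf : f.IsHomogeneous k)
    (c : ℂ) (v : σ → ℂ) :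
    MvPolynomial.eval (c • v) f = c ^ k * MvPolynomial.eval v f := by
  rw [MvPolynomial.eval_eq, MvPolynomial.eval_eq, Finset.mul_sum]
  refine Finset.sum_congr rfl fun m hm => ?_
  have hk : m.degree = k := by
    by_contra h
    exact (MvPolynomial.mem_support_iff.1 hm) (hf.coeff_eq_zero h)
  simp only [Pi.smul_apply, smul_eq_mul, mul_pow, Finset.prod_mul_distrib]
  rw [Finset.prod_pow_eq_pow_sum, ← Finsupp.degree_apply, hk]
  ring

theorem vanishesAt_mk {f : MvPolynomial σ ℂ} {k : ℕ} (hf : f.IsHomogeneous k) (v : σ → ℂ)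
    (hv : v ≠ 0) : VanishesAt f (Projectivization.mk ℂ v hv) ↔ MvPolynomial.eval v f = 0 := by
  obtain ⟨a, ha⟩ := Projectivization.exists_smul_eq_mk_rep ℂ v hv
  unfold VanishesAt
  rw [← ha, Units.smul_def, eval_smul_of_isHomogeneous hf]
  simp

theorem isHomogeneous_sum_C_mul_X [Fintype σ] (a : σ → ℂ) :
    (∑ q, MvPolynomial.C (a q) * MvPolynomial.X q : MvPolynomial σ ℂ).IsHomogeneous 1 :=
  MvPolynomial.IsHomogeneous.sum _ _ _ fun _ _ => MvPolynomial.isHomogeneous_C_mul_X _ _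

theorem exists_linear_polynomial [Finite σ] (Λ : (σ → ℂ) →ₗ[ℂ] ℂ) :
    ∃ f : MvPolynomial σ ℂ, f.IsHomogeneous 1 ∧ ∀ v, MvPolynomial.eval v f = Λ v := by
  classical
  have := Fintype.ofFinite σ
  refine ⟨∑ q, MvPolynomial.C (Λ (Pi.single q 1)) * MvPolynomial.X q,
    isHomogeneous_sum_C_mul_X _, fun v => ?_⟩
  conv_rhs => rw [pi_eq_sum_univ' v]
  simp [mul_comm]

/-- The determinant of a matrix of linear forms is a homogeneous polynomial. -/
theorem exists_det_polynomial [Finite σ] {κ : Type*} [Fintype κ] [DecidableEq κ]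
    (Λ : (σ → ℂ) →ₗ[ℂ] Matrix κ κ ℂ) :
    ∃ f : MvPolynomial σ ℂ, f.IsHomogeneous (Fintype.card κ) ∧
      ∀ v, MvPolynomial.eval v f = (Λ v).det := by
  choose L hL hL' using fun i j => exists_linear_polynomial (Matrix.entryLinearMap ℂ ℂ i j ∘ₗ Λ)
  refine ⟨(Matrix.of L).det, ?_, fun v => ?_⟩
  · rw [Matrix.det_apply]
    refine MvPolynomial.IsHomogeneous.sum _ _ _ fun τ _ => ?_
    rw [Units.smul_def, ← Int.cast_smul_eq_zsmul ℂ, MvPolynomial.smul_eq_C_mul]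
    refine MvPolynomial.IsHomogeneous.C_mul ?_ _
    have := MvPolynomial.IsHomogeneous.prod Finset.univ (fun i => L (τ i) i) (fun _ => 1)
      (fun i _ => hL _ _)
    simpa using this
  · rw [RingHom.map_det]
    congr 1
    ext i j
    exact hL' i j v

theorem exists_comp_polynomial [Finite σ] (φ : (σ → ℂ) →ₗ[ℂ] (σ → ℂ)) {f : MvPolynomial σ ℂ}
    {k : ℕ} (hf : f.IsHomogeneous k) :
    ∃ g : MvPolynomial σ ℂ, g.IsHomogeneous k ∧
      ∀ v, MvPolynomial.eval v g = MvPolynomial.eval (φ v) f := by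
  choose L hL hL' using fun i => exists_linear_polynomial (LinearMap.proj i ∘ₗ φ)
  refine ⟨MvPolynomial.aeval L f, by simpa using hf.aeval L hL, fun v => ?_⟩
  refine (MvPolynomial.eval₂Hom_bind₁ (RingHom.id ℂ) v L f).trans ?_
  have : (fun i => MvPolynomial.eval₂Hom (RingHom.id ℂ) v (L i)) = φ v :=
    funext fun i => hL' i v
  rw [this]
  rfl

theorem hasDerivAt_eval [Fintype σ] (f : MvPolynomial σ ℂ) {γ : ℂ → σ → ℂ} {w : σ → ℂ} {t : ℂ}
    (hγ : ∀ i, HasDerivAt (fun t => γ t i) (w i) t) :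
    HasDerivAt (fun t => MvPolynomial.eval (γ t) f) (differentialAt f (γ t) ⬝ᵥ w) t := by
  classical
  induction f using MvPolynomial.induction_on with
  | C a => simpa [differentialAt, dotProduct] using hasDerivAt_const t a
  | add p q hp hq =>
    convert! hp.add hq using 1
    · simp [Pi.add_def]
    · simp [differentialAt, dotProduct, add_mul, Finset.sum_add_distrib]
  | mul_X p i hp =>
    convert! hp.mul (hγ i) using 1
    · simp [Pi.mul_def]
    · simp [differentialAt, dotProduct, add_mul, Finset.sum_add_distrib, MvPolynomial.pderiv_X,
        Pi.single_apply, Finset.sum_mul, apply_ite, ite_mul]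
      rw [add_comm]
      exact congrArg (· + _) (Finset.sum_congr rfl fun _ _ => by ring)

/-- A polynomial whose restriction to a line through `v` is `t * q t` has derivative `q 0`. -/
theorem differentialAt_dotProduct_eq [Fintype σ] (f : MvPolynomial σ ℂ) (v w : σ → ℂ) (q : ℂ → ℂ)
    (hq : Continuous q) (h : ∀ t : ℂ, MvPolynomial.eval (v + t • w) f = t * q t) :
    differentialAt f v ⬝ᵥ w = q 0 := by
  have h1 : HasDerivAt (fun t : ℂ => MvPolynomial.eval (v + t • w) f)
      (differentialAt f (v + (0 : ℂ) • w) ⬝ᵥ w) 0 := by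
    refine hasDerivAt_eval f (γ := fun t => v + t • w) fun i => ?_
    simpa using ((hasDerivAt_id (0 : ℂ)).mul_const (w i)).const_add (v i)
  have h2 : HasDerivAt (fun t : ℂ => t * q t) (q 0) 0 := by
    rw [hasDerivAt_iff_tendsto_slope]
    refine Filter.Tendsto.congr' ?_ (hq.tendsto 0 |>.mono_left nhdsWithin_le_nhds)
    filter_upwards [self_mem_nhdsWithin] with t ht
    rw [slope_def_field]
    field_simp [show t ≠ 0 from ht]
    simp
  rw [show v = v + (0 : ℂ) • w by simp]
  exact h1.unique (by simpa only [h] using h2)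

/-- Velocities of curves in a variety are tangent vectors. -/
theorem mem_tangentSpace_of_curve [Fintype σ] (X : Set (ℙ ℂ (σ → ℂ))) (x : ℙ ℂ (σ → ℂ))
    (w u : σ → ℂ) (h : ∀ (t : ℂ) (ht : x.rep + t • w + t ^ 2 • u ≠ 0),
      Projectivization.mk ℂ (x.rep + t • w + t ^ 2 • u) ht ∈ X) :
    w ∈ tangentSpace X x := by
  rintro f ⟨⟨k, hk⟩, hf⟩
  have h1 : HasDerivAt (fun t : ℂ => MvPolynomial.eval (x.rep + t • w + t ^ 2 • u) f)
      (differentialAt f (x.rep + (0 : ℂ) • w + (0 : ℂ) ^ 2 • u) ⬝ᵥ w) 0 := by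
    refine hasDerivAt_eval f (γ := fun t => x.rep + t • w + t ^ 2 • u) fun i => ?_
    simpa [Pi.add_def] using (((hasDerivAt_id (0 : ℂ)).mul_const (w i)).const_add (x.rep i)).add
      (((hasDerivAt_id (0 : ℂ)).pow 2).mul_const (u i))
  have h2 : (fun t : ℂ => MvPolynomial.eval (x.rep + t • w + t ^ 2 • u) f) =ᶠ[nhds 0]
      fun _ => 0 := by
    have hc : Continuous fun t : ℂ => x.rep + t • w + t ^ 2 • u := by fun_prop
    filter_upwards [hc.continuousAt.eventually_ne (by simpa using x.rep_nonzero)] with t ht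
    exact (vanishesAt_mk hk _ ht).1 (hf _ (h t ht))
  have h3 := h1.unique ((hasDerivAt_const (0 : ℂ) (0 : ℂ)).congr_of_eventuallyEq h2)
  simpa using h3

theorem subset_zariskiClosure (S : Set (ℙ ℂ (σ → ℂ))) : S ⊆ zariskiClosure S :=
  fun _ hx _ hf => hf.2 _ hx

theorem vanishesAt_of_mem_zariskiClosure {S : Set (ℙ ℂ (σ → ℂ))} {f : MvPolynomial σ ℂ} {k : ℕ}
    (hk : f.IsHomogeneous k) (hf : ∀ x ∈ S, VanishesAt f x) {x : ℙ ℂ (σ → ℂ)}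
    (hx : x ∈ zariskiClosure S) : VanishesAt f x :=
  hx f ⟨⟨k, hk⟩, hf⟩

end Polynomials

/-! ### Symmetric matrices -/

section Symmetric

variable {ι : Type*} [Fintype ι] [DecidableEq ι]

/-- A complex symmetric matrix is diagonalized by a congruence; the diagonal entries are written
as squares. -/
theorem exists_congruence_diagonal (S : Matrix ι ι ℂ) (hS : Sᵀ = S) :
    ∃ (R V : Matrix ι ι ℂ) (z : ι → ℂ), Vᵀ * R = 1 ∧
      S = R * Matrix.diagonal (fun i => z i * z i) * Rᵀ := by
  obtain ⟨v, hv⟩ := LinearMap.BilinForm.exists_orthogonal_basis (B := Matrix.toBilin' S)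
    (LinearMap.BilinForm.isSymm_iff.1 (Matrix.isSymm_toBilin'_iff_isSymm.2 hS))
  have hcard : Fintype.card (Fin (Module.finrank ℂ (ι → ℂ))) = Fintype.card ι := by simp
  let b := v.reindex (Fintype.equivOfCardEq hcard)
  let V : Matrix ι ι ℂ := (Pi.basisFun ℂ ι).toMatrix b
  -- The columns of `V` are the orthogonal basis, and `R` is the inverse transpose of `V`.
  let R : Matrix ι ι ℂ := (b.toMatrix (Pi.basisFun ℂ ι))ᵀ
  have hVR : Vᵀ * R = 1 := by
    rw [← Matrix.transpose_mul, Module.Basis.toMatrix_mul_toMatrix_flip, Matrix.transpose_one]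
  have hRV : R * Vᵀ = 1 := mul_eq_one_comm.1 hVR
  have hD : ∀ i j, i ≠ j → (Vᵀ * S * V) i j = 0 := by
    intro i j hij
    have h := hv (show (Fintype.equivOfCardEq hcard).symm i ≠
      (Fintype.equivOfCardEq hcard).symm j by simpa using hij)
    rw [Matrix.mul_assoc]
    rw [Function.onFun, Matrix.toBilin'_apply'] at h
    have hb : ∀ k l, V k l = v ((Fintype.equivOfCardEq hcard).symm l) k := fun k l => by
      simp [V, b, Module.Basis.toMatrix_apply]
    rw [← h]
    simp only [Matrix.mul_apply, Matrix.transpose_apply, hb, dotProduct, Matrix.mulVec]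
  choose z hz using fun i => IsAlgClosed.exists_eq_mul_self ((Vᵀ * S * V) i i)
  refine ⟨R, V, z, hVR, ?_⟩
  have hD' : Vᵀ * S * V = Matrix.diagonal (fun i => z i * z i) := by
    ext i j
    by_cases hij : i = j
    · subst hij
      simp [hz]
    · rw [hD i j hij, Matrix.diagonal_apply_ne _ hij]
  have hVR' : V * Rᵀ = 1 := by
    rw [Matrix.transpose_transpose]
    exact Module.Basis.toMatrix_mul_toMatrix_flip _ _
  calc S = (R * Vᵀ) * S * (V * Rᵀ) := by rw [hRV, hVR', one_mul, mul_one]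
    _ = _ := by rw [← hD']; simp only [Matrix.mul_assoc]

/-- Over a square-diagonalized symmetric matrix, the nonzero diagonal entries count the rank. -/
theorem rank_congruence_diagonal {R V : Matrix ι ι ℂ} (z : ι → ℂ) (hVR : Vᵀ * R = 1) :
    (R * Matrix.diagonal (fun i => z i * z i) * Rᵀ).rank = Fintype.card {i // z i ≠ 0} := by
  have hR : IsUnit R.det := Matrix.isUnit_det_of_left_inverse hVR
  rw [Matrix.rank_mul_eq_left_of_isUnit_det _ _ (by simpa using hR),
    Matrix.rank_mul_eq_right_of_isUnit_det _ _ hR, Matrix.rank_diagonal]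
  exact Fintype.card_congr (Equiv.subtypeEquivRight fun i => by simp)

/-- The nonzero columns of `R * diagonal z` form a factor with `S.rank` columns; zero columns pad it
to width `k`. -/
theorem exists_eq_mul_transpose {k : ℕ} (S : Matrix ι ι ℂ) (hS : Sᵀ = S) (hk : S.rank ≤ k) :
    ∃ P : Matrix ι (Fin k) ℂ, S = P * Pᵀ := by
  obtain ⟨R, V, z, hVR, rfl⟩ := exists_congruence_diagonal S hS
  rw [rank_congruence_diagonal z hVR] at hk
  obtain ⟨emb⟩ := Function.Embedding.nonempty_of_card_le (α := {i // z i ≠ 0}) (β := Fin k)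
    (by simpa using hk)
  obtain ⟨Q, hQ⟩ : ∃ Q : Matrix ι {i // z i ≠ 0} ℂ,
      R * Matrix.diagonal (fun i => z i * z i) * Rᵀ = Q * Qᵀ := by
    refine ⟨Matrix.of fun i j => R i j.1 * z j.1, ?_⟩
    ext i j
    rw [Matrix.mul_apply, Matrix.mul_apply]
    simp only [Matrix.mul_diagonal, Matrix.transpose_apply, Matrix.of_apply]
    rw [← Finset.sum_subtype (Finset.univ.filter fun l => z l ≠ 0) (by simp)
      (fun l => R i l * z l * (R j l * z l)), Finset.sum_filter_of_ne]
    · exact Finset.sum_congr rfl fun l _ => by ring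
    · intro l _ hl h0
      simp [h0] at hl
  obtain ⟨E, hE⟩ : ∃ E : Matrix {i // z i ≠ 0} (Fin k) ℂ, E * Eᵀ = 1 := by
    refine ⟨(1 : Matrix (Fin k) (Fin k) ℂ).submatrix emb id, ?_⟩
    rw [Matrix.transpose_submatrix, Matrix.transpose_one,
      ← Matrix.submatrix_mul _ _ _ _ _ Function.bijective_id, one_mul,
      Matrix.submatrix_one _ emb.injective]
  refine ⟨Q * E, ?_⟩
  rw [hQ, Matrix.transpose_mul, Matrix.mul_assoc, ← Matrix.mul_assoc E, hE, Matrix.one_mul]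

end Symmetric

/-! ### Cayley-Menger varieties as determinantal varieties -/

section Determinantal

variable {n : ℕ}

/-- A homogeneous polynomial vanishing at all real configurations vanishes at all complex ones. -/
theorem eval_complexSquaredDistances_eq_zero {k : ℕ} {f : MvPolynomial (Pairs n) ℂ} {m : ℕ}
    (hm : f.IsHomogeneous m) (hf : ∀ p : Configuration n k, VanishesAt f (distancePoint p))
    (p : Fin n × Fin k → ℂ) (hp : complexSquaredDistances p ≠ 0) :
    MvPolynomial.eval (complexSquaredDistances p) f = 0 := by
  let D : Pairs n → MvPolynomial (Fin n × Fin k) ℂ := fun q =>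
    ∑ l, (MvPolynomial.X (q.1.1, l) - MvPolynomial.X (q.1.2, l)) ^ 2
  have hD : ∀ p : Fin n × Fin k → ℂ,
      (fun q => MvPolynomial.eval p (D q)) = complexSquaredDistances p := by
    intro p
    funext q
    simp [D, complexSquaredDistances]
  have hfD : ∀ p, MvPolynomial.eval p (MvPolynomial.bind₁ D f) =
      MvPolynomial.eval (complexSquaredDistances p) f := by
    intro p
    rw [← hD]
    exact MvPolynomial.eval₂Hom_bind₁ (RingHom.id ℂ) p D f
  obtain ⟨q, hq⟩ := Function.ne_iff.1 hp
  -- The hypothesis says nothing about real tuples whose points all coincide. The factor `D q`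
  -- vanishes on them, so the product vanishes at all real tuples and is zero; `D q` is nonzero at
  -- `p` and can be cancelled there.
  have hzero : MvPolynomial.bind₁ D f * D q = 0 := by
    refine MvPolynomial.funext_set (fun _ => Set.range ((↑) : ℝ → ℂ))
      (fun _ => Set.infinite_range_of_injective Complex.ofReal_injective) fun r hr => ?_
    choose r' hr' using fun a => hr a (Set.mem_univ a)
    obtain rfl : (fun a => (r' a : ℂ)) = r := funext hr'
    rw [map_mul, map_zero, hfD]
    by_cases hne : ∃ i j, (fun l => r' (i, l)) ≠ fun l => r' (j, l)
    · obtain ⟨i, j, hij⟩ := hne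
      let c : Configuration n k := ⟨fun i => WithLp.toLp 2 fun l => r' (i, l), i, j, fun h =>
        hij (congrArg WithLp.ofLp h)⟩
      have h0 := (vanishesAt_mk hm _ (squaredDistances_ne_zero c)).1 (hf c)
      rw [squaredDistances_eq_complex] at h0
      rw [show (fun a => (r' a : ℂ)) = fun a => ((c.1 a.1 a.2 : ℝ) : ℂ) from rfl, h0, zero_mul]
    · push Not at hne
      have h0 : MvPolynomial.eval (fun a => (r' a : ℂ)) (D q) = 0 := by
        simp only [D, map_sum, map_pow, map_sub, MvPolynomial.eval_X]
        exact Finset.sum_eq_zero fun l _ => by rw [congrFun (hne q.1.1 q.1.2) l]; simp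
      rw [h0, mul_zero]
  have := congrArg (MvPolynomial.eval p) hzero
  rw [map_mul, map_zero, hfD, congrFun (hD p) q] at this
  exact (mul_eq_zero.1 this).resolve_right hq

theorem det_submatrix_eq_zero_of_rank_lt {ι κ : Type*} [Fintype ι] [Fintype κ] [DecidableEq κ]
    (M : Matrix ι ι ℂ) (h : M.rank < Fintype.card κ) (r c : κ → ι) :
    (M.submatrix r c).det = 0 := by
  by_contra hne
  have h1 := Matrix.rank_of_det_ne_zero hne
  have h2 := Matrix.rank_submatrix_le M r c
  omega

theorem rank_gramLinear_squaredDistances_le {k : ℕ} (o : Fin n) (p : Configuration n k) :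
    (gramLinear o (squaredDistances p)).rank ≤ k := by
  rw [squaredDistances_eq_complex, gramLinear_complexSquaredDistances]
  exact ((Matrix.rank_mul_le_left _ _).trans (Matrix.rank_le_card_width _)).trans (by simp)

theorem mk_mem_cayleyMenger_iff (k : ℕ) (o : Fin n) (s : Pairs n → ℂ) (hs : s ≠ 0) :
    Projectivization.mk ℂ s hs ∈ cayleyMenger k n ↔ (gramLinear o s).rank ≤ k := by
  constructor
  · intro hx
    by_contra! hlt
    -- In diagonalizing coordinates a principal minor of size `k + 1` is a product of nonzero
    -- squares at `s`, yet it vanishes at every configuration in dimension `k`.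
    obtain ⟨R, V, z, hVR, hS⟩ := exists_congruence_diagonal _ (gramLinear_transpose o s)
    have hcard : k + 1 ≤ Fintype.card {i // z i ≠ 0} := by
      rw [← rank_congruence_diagonal z hVR, ← hS]
      exact hlt
    obtain ⟨emb⟩ := Function.Embedding.nonempty_of_card_le (α := Fin (k + 1))
      (β := {i // z i ≠ 0}) (by simpa using hcard)
    let Λ : (Pairs n → ℂ) →ₗ[ℂ] Matrix (Fin (k + 1)) (Fin (k + 1)) ℂ :=
      { toFun := fun s => (Vᵀ * gramLinear o s * V).submatrix (fun i => (emb i).1)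
          (fun i => (emb i).1)
        map_add' := fun s t => by simp [Matrix.mul_add, Matrix.add_mul, Matrix.submatrix_add]
        map_smul' := fun c s => by simp [Matrix.submatrix_smul] }
    obtain ⟨f, hf, hev⟩ := exists_det_polynomial Λ
    have hvan := vanishesAt_of_mem_zariskiClosure hf (fun x hx => by
      obtain ⟨p, rfl⟩ := hx
      refine (vanishesAt_mk hf _ (squaredDistances_ne_zero p)).2 ?_
      rw [hev]
      refine det_submatrix_eq_zero_of_rank_lt _ ?_ _ _
      rw [Fintype.card_fin, Nat.lt_succ_iff]
      exact ((Matrix.rank_mul_le_left _ _).trans (Matrix.rank_mul_le_right _ _)).trans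
        (rank_gramLinear_squaredDistances_le o p)) hx
    rw [vanishesAt_mk hf, hev] at hvan
    have hdiag : Vᵀ * gramLinear o s * V = Matrix.diagonal fun i => z i * z i := by
      have hRV : Rᵀ * V = 1 := by
        rw [← Matrix.transpose_one, ← hVR, Matrix.transpose_mul, Matrix.transpose_transpose]
      rw [hS]
      calc Vᵀ * (R * Matrix.diagonal (fun i => z i * z i) * Rᵀ) * V
          = (Vᵀ * R) * Matrix.diagonal (fun i => z i * z i) * (Rᵀ * V) := by
            simp only [Matrix.mul_assoc]
        _ = _ := by rw [hVR, hRV, one_mul, mul_one]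
    have hΛ : Λ s = Matrix.diagonal fun i => z (emb i).1 * z (emb i).1 := by
      change (Vᵀ * gramLinear o s * V).submatrix _ _ = _
      rw [hdiag]
      exact Matrix.submatrix_diagonal _ _ (Subtype.val_injective.comp emb.injective)
    rw [hΛ, Matrix.det_diagonal, Finset.prod_eq_zero_iff] at hvan
    obtain ⟨i, -, hi⟩ := hvan
    exact (emb i).2 (mul_self_eq_zero.1 hi)
  · rintro hr f ⟨⟨m, hm⟩, hf⟩
    obtain ⟨P, hP⟩ := exists_eq_mul_transpose _ (gramLinear_transpose o s) hr
    obtain ⟨p, rfl⟩ := complexSquaredDistances_eq o P s hP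
    exact (vanishesAt_mk hm _ hs).2
      (eval_complexSquaredDistances_eq_zero hm (fun p => hf _ ⟨p, rfl⟩) p hs)

theorem mem_cayleyMenger_iff (k : ℕ) (o : Fin n) (x : ℙ ℂ (Pairs n → ℂ)) :
    x ∈ cayleyMenger k n ↔ (gramLinear o x.rep).rank ≤ k := by
  rw [← mk_mem_cayleyMenger_iff k o x.rep x.rep_nonzero, Projectivization.mk_rep]

/-- Appending `v` to `P` as a column factors the sum through `k + 1` dimensions. Hence every
direction `v * vᵀ` is tangent at points of deficient rank. -/
theorem mul_transpose_add_smul_vecMulVec_rank_le {ι : Type*} [Fintype ι] {k : ℕ}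
    (P : Matrix ι (Fin k) ℂ) (t : ℂ) (v : ι → ℂ) :
    (P * Pᵀ + t • Matrix.vecMulVec v v).rank ≤ k + 1 := by
  have h : P * Pᵀ + t • Matrix.vecMulVec v v =
      Matrix.fromCols P (Matrix.replicateCol Unit v) *
        Matrix.fromRows Pᵀ (Matrix.replicateRow Unit (t • v)) := by
    rw [Matrix.fromCols_mul_fromRows, Matrix.vecMulVec_eq Unit]
    congr 1
    ext i j
    simp [Matrix.mul_apply]
    ring
  rw [h]
  exact ((Matrix.rank_mul_le_left _ _).trans (Matrix.rank_le_card_width _)).trans (by simp)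

/-- The trace is the quadratic form of `B` at `v`, and polarization recovers `B`. -/
theorem eq_zero_of_trace_mul_vecMulVec {ι : Type*} [Fintype ι] (B : Matrix ι ι ℂ) (hB : Bᵀ = B)
    (h : ∀ v : ι → ℂ, (B * Matrix.vecMulVec v v).trace = 0) : B = 0 := by
  classical
  have key : ∀ v : ι → ℂ, v ⬝ᵥ B *ᵥ v = 0 := by
    intro v
    rw [← h v, Matrix.mul_vecMulVec, Matrix.trace_vecMulVec, dotProduct_comm]
  have hs : ∀ i j, B j i = B i j := fun i j => congrFun (congrFun hB i) j
  ext i j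
  have hi := key (Pi.single i 1)
  have hj := key (Pi.single j 1)
  have hij := key (Pi.single i 1 + Pi.single j 1)
  simp [Matrix.mulVec_add] at hi hj hij
  rw [hs i j] at hij
  rw [Matrix.zero_apply]
  linear_combination (hij - hi - hj) / 2

/-- A hyperplane that contains a tangent space of a Cayley-Menger variety corresponds to a
symmetric matrix of complementary rank. -/
theorem rank_le_of_tangent (d : ℕ) (hd : 1 ≤ d) (o : Fin n) {x : ℙ ℂ (Pairs n → ℂ)}
    (hx : x ∈ cayleyMenger d n) (b : Pairs n → ℂ) (hb : b ≠ 0)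
    (h : ∀ w ∈ tangentSpace (cayleyMenger d n) x,
      (gramLinear o b * gramLinear o w).trace = 0) :
    (gramLinear o b).rank ≤ n - d - 1 := by
  have hcurve : ∀ w u : Pairs n → ℂ,
      (∀ t : ℂ, (gramLinear o x.rep + t • gramLinear o w + t ^ 2 • gramLinear o u).rank ≤ d) →
      (gramLinear o b * gramLinear o w).trace = 0 := by
    intro w u hwu
    refine h w (mem_tangentSpace_of_curve _ x w u fun t ht => ?_)
    rw [mk_mem_cayleyMenger_iff d o]
    simpa using hwu t
  rw [mem_cayleyMenger_iff d o] at hx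
  have hsymm := gramLinear_transpose o x.rep
  -- Below rank `d`, all rank-one directions are tangent, which would force `b = 0`.
  rcases hx.lt_or_eq with hlt | heq
  · exfalso
    obtain ⟨k, rfl⟩ : ∃ k, d = k + 1 := ⟨d - 1, by omega⟩
    obtain ⟨P, hP⟩ := exists_eq_mul_transpose _ hsymm (Nat.lt_succ_iff.1 hlt)
    refine hb (gramLinear_injective o ?_)
    rw [map_zero]
    refine eq_zero_of_trace_mul_vecMulVec _ (gramLinear_transpose o b) fun v => ?_
    obtain ⟨w, hw⟩ := exists_gramLinear_eq o (Matrix.vecMulVec v v) (Matrix.transpose_vecMulVec v v)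
    rw [← hw]
    refine hcurve w 0 fun t => ?_
    rw [hw, hP, map_zero, smul_zero, add_zero]
    exact mul_transpose_add_smul_vecMulVec_rank_le P t v
  · obtain ⟨P, hP⟩ := exists_eq_mul_transpose _ hsymm hx
    have hPr : d ≤ P.rank := by
      refine heq.symm.le.trans ?_
      rw [hP]
      exact Matrix.rank_mul_le_left _ _
    have hBP : gramLinear o b * P = 0 := by
      have hQ : ∀ Q : Matrix {i : Fin n // i ≠ o} (Fin d) ℂ,
          (gramLinear o b * (P * Qᵀ + Q * Pᵀ)).trace = 0 := by
        intro Q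
        obtain ⟨w, hw⟩ := exists_gramLinear_eq o (P * Qᵀ + Q * Pᵀ) (by
          simp [Matrix.transpose_mul, add_comm])
        -- The second-order term `u` completes the curve to `(P + tQ) * (P + tQ)ᵀ`, which stays in
        -- rank at most `d`.
        obtain ⟨u, hu⟩ := exists_gramLinear_eq o (Q * Qᵀ) (by simp [Matrix.transpose_mul])
        rw [← hw]
        refine hcurve w u fun t => ?_
        have : gramLinear o x.rep + t • gramLinear o w + t ^ 2 • gramLinear o u =
            (P + t • Q) * (P + t • Q)ᵀ := by
          rw [hP, hw, hu]
          simp only [Matrix.transpose_add, Matrix.transpose_smul, Matrix.add_mul, Matrix.mul_add,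
            Matrix.smul_mul, Matrix.mul_smul, smul_add, smul_smul, pow_two]
          abel
        rw [this]
        exact ((Matrix.rank_mul_le_left _ _).trans (Matrix.rank_le_card_width _)).trans (by simp)
      have hQ' : ∀ Q : Matrix {i : Fin n // i ≠ o} (Fin d) ℂ,
          (gramLinear o b * P * Qᵀ).trace = 0 := by
        intro Q
        have h1 := hQ Q
        have h2 : (gramLinear o b * (Q * Pᵀ)).trace = (gramLinear o b * (P * Qᵀ)).trace := by
          rw [← Matrix.trace_transpose, Matrix.transpose_mul, gramLinear_transpose,
            Matrix.trace_mul_comm, Matrix.transpose_mul, Matrix.transpose_transpose]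
        rw [Matrix.mul_add, Matrix.trace_add, h2] at h1
        rw [Matrix.mul_assoc]
        linear_combination h1 / 2
      -- This `Q` turns the trace into the squared Frobenius norm of `B * P`.
      have h3 := hQ' ((gramLinear o b * P)ᴴ)ᵀ
      open scoped ComplexOrder in
      rwa [Matrix.transpose_transpose, Matrix.trace_mul_conjTranspose_self_eq_zero_iff] at h3
    have := Matrix.rank_add_rank_le_card_of_mul_eq_zero hBP
    have hc : Fintype.card {i : Fin n // i ≠ o} = n - 1 := by simp
    omega

end Determinantal

/-! ### Bordered minors -/

section Bordered

variable {ι : Type*} (p : ι → Prop)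

/-- The principal submatrix with indices in `p`, bordered by the row `a` and the column `b`. -/
def bordered (T : Matrix ι ι ℂ) (a b : ι) :
    Matrix ({i // p i} ⊕ Unit) ({i // p i} ⊕ Unit) ℂ :=
  T.submatrix (Sum.elim (↑) fun _ => a) (Sum.elim (↑) fun _ => b)

variable {p} [Fintype ι] [DecidableEq ι] [DecidablePred p]

theorem det_bordered_symm {T : Matrix ι ι ℂ} (hT : Tᵀ = T) (a b : ι) :
    (bordered p T b a).det = (bordered p T a b).det := by
  rw [← Matrix.det_transpose, bordered, Matrix.transpose_submatrix, hT, bordered]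

theorem det_bordered_of_mem_left {T : Matrix ι ι ℂ} {a : ι} (ha : p a) (b : ι) :
    (bordered p T a b).det = 0 :=
  Matrix.det_zero_of_row_eq (i := Sum.inl ⟨a, ha⟩) (j := Sum.inr ()) (by simp) rfl

theorem det_bordered_of_mem_right {T : Matrix ι ι ℂ} (a : ι) {b : ι} (hb : p b) :
    (bordered p T a b).det = 0 :=
  Matrix.det_zero_of_column_eq (i := Sum.inl ⟨b, hb⟩) (j := Sum.inr ()) (by simp) fun _ => rfl

/-- Schur complement: with `G` the invertible principal block, the bordered minor at `(a, b)` is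
`det G` times the `(a, b)` entry of `T - C * G⁻¹ * B`. So `T = C * G⁻¹ * B`, which factors through
the size of `G`. -/
theorem rank_le_of_det_bordered_eq_zero {T : Matrix ι ι ℂ}
    (h0 : (T.submatrix ((↑) : {i // p i} → ι) (↑)).det ≠ 0)
    (h : ∀ a b, ¬ p a → ¬ p b → (bordered p T a b).det = 0) :
    T.rank ≤ Fintype.card {i // p i} := by
  let G : Matrix {i // p i} {i // p i} ℂ := T.submatrix Subtype.val Subtype.val
  have hu : IsUnit G.det := h0.isUnit
  let C : Matrix ι {i // p i} ℂ := T.submatrix id Subtype.val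
  let B : Matrix {i // p i} ι ℂ := T.submatrix Subtype.val id
  have hT : T = C * G⁻¹ * B := by
    ext a b
    have hab : (bordered p T a b).det = 0 := by
      by_cases ha : p a
      · exact det_bordered_of_mem_left ha b
      by_cases hb : p b
      · exact det_bordered_of_mem_right a hb
      exact h a b ha hb
    have hblock : bordered p T a b = Matrix.fromBlocks G
        (Matrix.of fun i _ => T i.1 b) (Matrix.of fun _ j => T a j.1)
        (Matrix.of fun _ _ => T a b) := by
      ext (i | i) (j | j) <;> rfl
    let := Matrix.invertibleOfIsUnitDet G hu
    rw [hblock, Matrix.det_fromBlocks₁₁, mul_eq_zero] at hab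
    have h1 := hab.resolve_left h0
    rw [Matrix.det_unique, Matrix.sub_apply, sub_eq_zero, Matrix.invOf_eq_nonsing_inv] at h1
    exact h1
  rw [hT, Matrix.mul_assoc]
  exact (Matrix.rank_mul_le_left _ _).trans (Matrix.rank_le_card_width _)

/-- The bordering column is divisible by `t`; `q t` is the determinant after this factor is removed,
and at `t = 0` it is block triangular. Its value there is the derivative of the bordered minor in
the direction `W`. -/
theorem exists_det_bordered_line (y : ι → ℂ) (W : Matrix ι ι ℂ) {a b : ι} (ha : y a = 0)
    (hb : y b = 0) :
    ∃ q : ℂ → ℂ, Continuous q ∧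
      (∀ t, (bordered (fun i => y i ≠ 0) (Matrix.diagonal y + t • W) a b).det = t * q t) ∧
      q 0 = (∏ i : {i // y i ≠ 0}, y i) * W a b := by
  let M : ℂ → Matrix ({i // y i ≠ 0} ⊕ Unit) ({i // y i ≠ 0} ⊕ Unit) ℂ := fun t =>
    Matrix.fromBlocks (Matrix.diagonal (fun i => y i.1) + t • W.submatrix (↑) (↑))
      (Matrix.of fun i _ => W i.1 b) (t • Matrix.of fun _ j => W a j.1)
      (Matrix.of fun _ _ => W a b)
  refine ⟨fun t => (M t).det, ?_, fun t => ?_, ?_⟩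
  · refine Continuous.matrix_det (Continuous.matrix_fromBlocks ?_ ?_ ?_ ?_) <;> fun_prop
  · have : bordered (fun i => y i ≠ 0) (Matrix.diagonal y + t • W) a b =
        M t * Matrix.fromBlocks 1 0 0 (t • (1 : Matrix Unit Unit ℂ)) := by
      rw [Matrix.fromBlocks_multiply]
      ext (i | i) (j | j)
      · simp [bordered, Matrix.diagonal_apply, Subtype.ext_iff]
      · have : i.1 ≠ b := fun h => i.2 (h ▸ hb)
        simp [bordered, this]
      · have : a ≠ j.1 := fun h => j.2 (h ▸ ha)
        simp [bordered, this]
      · simp [bordered, Matrix.diagonal_apply, ha]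
    rw [this, Matrix.det_mul, Matrix.det_fromBlocks_zero₂₁]
    simp [mul_comm]
  · have : M 0 = Matrix.fromBlocks (Matrix.diagonal (fun i => y i.1))
        (Matrix.of fun i _ => W i.1 b) 0 (Matrix.of fun _ _ => W a b) := by
      simp [M]
    simp only [this, Matrix.det_fromBlocks_zero₂₁, Matrix.det_diagonal, Matrix.det_unique,
      Matrix.of_apply]

end Bordered

/-! ### Smooth points of Cayley-Menger varieties -/

section Smooth

variable {n : ℕ} {d : ℕ} {o : Fin n}

/-- The Gram matrix in the coordinates given by a congruence. -/
noncomputable def congruenceLinear (o : Fin n)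
    (R : Matrix {i : Fin n // i ≠ o} {i : Fin n // i ≠ o} ℂ) :
    (Pairs n → ℂ) →ₗ[ℂ] Matrix {i : Fin n // i ≠ o} {i : Fin n // i ≠ o} ℂ :=
  LinearMap.mulRight ℂ R ∘ₗ LinearMap.mulLeft ℂ Rᵀ ∘ₗ gramLinear o

theorem congruenceLinear_apply (R : Matrix {i : Fin n // i ≠ o} {i : Fin n // i ≠ o} ℂ)
    (s : Pairs n → ℂ) : congruenceLinear o R s = Rᵀ * gramLinear o s * R := rfl

theorem congruenceLinear_transpose (R : Matrix {i : Fin n // i ≠ o} {i : Fin n // i ≠ o} ℂ)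
    (s : Pairs n → ℂ) : (congruenceLinear o R s)ᵀ = congruenceLinear o R s := by
  simp [congruenceLinear_apply, Matrix.transpose_mul, gramLinear_transpose, Matrix.mul_assoc]

theorem rank_congruenceLinear {R V : Matrix {i : Fin n // i ≠ o} {i : Fin n // i ≠ o} ℂ}
    (hVR : Vᵀ * R = 1) (s : Pairs n → ℂ) :
    (congruenceLinear o R s).rank = (gramLinear o s).rank := by
  have hR : IsUnit R.det := Matrix.isUnit_det_of_left_inverse hVR
  rw [congruenceLinear_apply, Matrix.rank_mul_eq_left_of_isUnit_det _ _ hR,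
    Matrix.rank_mul_eq_right_of_isUnit_det _ _ (by simpa using hR)]

theorem exists_congruenceLinear_eq {R V : Matrix {i : Fin n // i ≠ o} {i : Fin n // i ≠ o} ℂ}
    (hVR : Vᵀ * R = 1) (M : Matrix {i : Fin n // i ≠ o} {i : Fin n // i ≠ o} ℂ) (hM : Mᵀ = M) :
    ∃ s, congruenceLinear o R s = M := by
  obtain ⟨s, hs⟩ := exists_gramLinear_eq o (V * M * Vᵀ) (by
    simp [Matrix.transpose_mul, hM, Matrix.mul_assoc])
  have hRV : Rᵀ * V = 1 := by
    rw [← Matrix.transpose_one, ← hVR, Matrix.transpose_mul, Matrix.transpose_transpose]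
  refine ⟨s, ?_⟩
  rw [congruenceLinear_apply, hs]
  calc Rᵀ * (V * M * Vᵀ) * R = (Rᵀ * V) * M * (Vᵀ * R) := by simp only [Matrix.mul_assoc]
    _ = M := by rw [hVR, hRV, one_mul, mul_one]

/-- The bordered minors at a diagonal point of rank `d`, as polynomials vanishing on the
Cayley-Menger variety. -/
theorem exists_bordered_polynomials {R V : Matrix {i : Fin n // i ≠ o} {i : Fin n // i ≠ o} ℂ}
    (hVR : Vᵀ * R = 1) {y : {i : Fin n // i ≠ o} → ℂ}
    (hcard : Fintype.card {i // y i ≠ 0} = d) {v : Pairs n → ℂ}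
    (hv : congruenceLinear o R v = Matrix.diagonal y) :
    ∃ F : {i : Fin n // i ≠ o} → {i : Fin n // i ≠ o} → MvPolynomial (Pairs n) ℂ,
      (∀ a b, F a b ∈ homogeneousVanishing (cayleyMenger d n)) ∧
      (∀ a b s, MvPolynomial.eval s (F a b) =
        (bordered (fun i => y i ≠ 0) (congruenceLinear o R s) a b).det) ∧
      ∀ a b, y a = 0 → y b = 0 → ∀ w, differentialAt (F a b) v ⬝ᵥ w =
        (∏ i : {i // y i ≠ 0}, y i) * congruenceLinear o R w a b := by
  let Λ : {i : Fin n // i ≠ o} → {i : Fin n // i ≠ o} → (Pairs n → ℂ) →ₗ[ℂ]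
      Matrix ({i // y i ≠ 0} ⊕ Unit) ({i // y i ≠ 0} ⊕ Unit) ℂ := fun a b =>
    { toFun := fun s => bordered (fun i => y i ≠ 0) (congruenceLinear o R s) a b
      map_add' := fun s t => by simp [bordered, Matrix.submatrix_add]
      map_smul' := fun c s => by simp [bordered, Matrix.submatrix_smul] }
  choose F hF hev using fun a b => exists_det_polynomial (Λ a b)
  have hcard' : Fintype.card ({i // y i ≠ 0} ⊕ Unit) = d + 1 := by
    rw [Fintype.card_sum, hcard, Fintype.card_unit]
  refine ⟨F, fun a b => ⟨⟨_, hF a b⟩, fun x hx => ?_⟩, hev,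
    fun a b ha hb w => ?_⟩
  · refine (hev a b _).trans (det_submatrix_eq_zero_of_rank_lt _ ?_ _ _)
    rw [hcard', Nat.lt_succ_iff, rank_congruenceLinear hVR]
    exact (mem_cayleyMenger_iff d o x).1 hx
  · obtain ⟨q, hq, hline, hq0⟩ := exists_det_bordered_line y (congruenceLinear o R w) ha hb
    rw [← hq0]
    refine differentialAt_dotProduct_eq _ _ _ q hq fun t => ?_
    rw [hev, ← hline]
    change (bordered _ (congruenceLinear o R (v + t • w)) a b).det = _
    rw [map_add, map_smul, hv]

/-- The upper bound on the tangent space: the differential of the bordered minor at `(a, b)` is a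
nonzero multiple of the entry `(a, b)`. -/
theorem congruenceLinear_eq_zero_of_mem_tangentSpace
    {R V : Matrix {i : Fin n // i ≠ o} {i : Fin n // i ≠ o} ℂ}
    (hVR : Vᵀ * R = 1) {y : {i : Fin n // i ≠ o} → ℂ}
    (hcard : Fintype.card {i // y i ≠ 0} = d) {x : ℙ ℂ (Pairs n → ℂ)}
    (hx : congruenceLinear o R x.rep = Matrix.diagonal y) {w : Pairs n → ℂ}
    (hw : w ∈ tangentSpace (cayleyMenger d n) x) {a b : {i : Fin n // i ≠ o}} (ha : y a = 0)
    (hb : y b = 0) : congruenceLinear o R w a b = 0 := by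
  obtain ⟨F, hF, -, hd⟩ := exists_bordered_polynomials hVR hcard hx
  have h := hw _ (hF a b)
  rw [hd a b ha hb w] at h
  exact (mul_eq_zero.1 h).resolve_left (Finset.prod_ne_zero_iff.2 fun i _ => i.2)

/-- The bordered minors are local equations where the principal minor `g` on the support of `y` is
nonzero, and their differentials are multiples of distinct matrix entries. -/
theorem isSmoothPoint_cayleyMenger
    {R V : Matrix {i : Fin n // i ≠ o} {i : Fin n // i ≠ o} ℂ}
    (hVR : Vᵀ * R = 1) {y : {i : Fin n // i ≠ o} → ℂ}
    (hcard : Fintype.card {i // y i ≠ 0} = d) {x : ℙ ℂ (Pairs n → ℂ)}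
    (hx : congruenceLinear o R x.rep = Matrix.diagonal y) :
    IsSmoothPoint (cayleyMenger d n) x := by
  obtain ⟨F, hF, hev, hd⟩ := exists_bordered_polynomials hVR hcard hx
  have hprod : (∏ i : {i // y i ≠ 0}, y i) ≠ 0 := Finset.prod_ne_zero_iff.2 fun i _ => i.2
  -- By symmetry the minors at `(a, b)` and `(b, a)` agree, so independence requires one of each
  -- pair.
  let K := {c : {i : Fin n // i ≠ o} × {i : Fin n // i ≠ o} //
    y c.1 = 0 ∧ y c.2 = 0 ∧ c.1 ≤ c.2}
  let φ : Fin (Fintype.card K) ≃ K := (Fintype.equivFin K).symm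
  let Λ : (Pairs n → ℂ) →ₗ[ℂ] Matrix {i // y i ≠ 0} {i // y i ≠ 0} ℂ :=
    { toFun := fun s => (congruenceLinear o R s).submatrix (↑) (↑)
      map_add' := fun s t => by simp [Matrix.submatrix_add]
      map_smul' := fun c s => by simp [Matrix.submatrix_smul] }
  obtain ⟨g, hg, hgev⟩ := exists_det_polynomial Λ
  refine ⟨?_, Fintype.card K, fun i => F (φ i).1.1 (φ i).1.2, g, fun i => hF _ _, ?_, ⟨_, hg⟩,
    ?_, ?_⟩
  · rw [mem_cayleyMenger_iff d o, ← rank_congruenceLinear hVR, hx, Matrix.rank_diagonal]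
    exact hcard.le
  · have hK : LinearIndependent ℂ fun c : K => differentialAt (F c.1.1 c.1.2) x.rep := by
      rw [Fintype.linearIndependent_iff]
      rintro u hu ⟨⟨a, b⟩, ha, hb, hab⟩
      -- A symmetric test direction on which only the differential indexed by `(a, b)` is nonzero.
      obtain ⟨w, hw⟩ := exists_congruenceLinear_eq hVR
        (Matrix.single a b (1 : ℂ) + Matrix.single b a 1) (by simp [add_comm])
      have h1 := congrArg (· ⬝ᵥ w) hu
      simp only [zero_dotProduct, sum_dotProduct, smul_dotProduct] at h1
      rw [Finset.sum_eq_single ⟨(a, b), ha, hb, hab⟩] at h1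
      · rw [hd a b ha hb, hw, smul_eq_mul, ← mul_assoc] at h1
        rcases mul_eq_zero.1 h1 with h2 | h2
        · exact (mul_eq_zero.1 h2).resolve_right hprod
        · exfalso
          by_cases h : a = b
          · subst h
            norm_num [Matrix.single_apply] at h2
          · simp [h, Ne.symm h] at h2
      · rintro ⟨⟨a', b'⟩, ha', hb', hab'⟩ - hne
        rw [hd a' b' ha' hb', hw]
        have h3 : ¬ (a = a' ∧ b = b') := by
          rintro ⟨rfl, rfl⟩
          exact hne rfl
        have h4 : ¬ (b = a' ∧ a = b') := by
          dsimp only at hab hab'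
          rintro ⟨rfl, rfl⟩
          obtain rfl := le_antisymm hab hab'
          exact hne rfl
        simp [h3, h4]
      · simp
    exact hK.comp φ φ.injective
  · rw [VanishesAt, hgev]
    change ((congruenceLinear o R x.rep).submatrix _ _).det ≠ 0
    rw [hx, Matrix.submatrix_diagonal _ _ Subtype.val_injective, Matrix.det_diagonal]
    exact hprod
  · intro z hz hFz
    rw [mem_cayleyMenger_iff d o, ← rank_congruenceLinear hVR, ← hcard]
    refine rank_le_of_det_bordered_eq_zero (by rwa [VanishesAt, hgev] at hz) fun a b ha hb => ?_
    have key : ∀ a b, y a = 0 → y b = 0 → a ≤ b →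
        (bordered (fun i => y i ≠ 0) (congruenceLinear o R z.rep) a b).det = 0 := by
      intro a b ha hb hab
      have := hFz (φ.symm ⟨(a, b), ha, hb, hab⟩)
      beta_reduce at this
      rwa [Equiv.apply_symm_apply, VanishesAt, hev] at this
    rw [not_ne_iff] at ha hb
    rcases le_total a b with hab | hab
    · exact key a b ha hb hab
    · rw [← det_bordered_symm (congruenceLinear_transpose R _)]
      exact key b a hb ha hab

end Smooth

/-! ### The dual variety -/

section Dual

variable {n : ℕ}

/-- Every symmetric matrix of rank at most `n - d - 1` is normal to the variety at a smooth
point. -/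
theorem exists_smooth_tangent (d : ℕ) (hd : 1 ≤ d) (hdn : d ≤ n - 1) (o : Fin n)
    (b : Pairs n → ℂ) (hb : (gramLinear o b).rank ≤ n - d - 1) :
    ∃ x, IsSmoothPoint (cayleyMenger d n) x ∧ ∀ w ∈ tangentSpace (cayleyMenger d n) x,
      (gramLinear o b * gramLinear o w).trace = 0 := by
  obtain ⟨R, V, z, hVR, hS⟩ := exists_congruence_diagonal _ (gramLinear_transpose o b)
  rw [hS, rank_congruence_diagonal z hVR] at hb
  have hc : Fintype.card {i : Fin n // i ≠ o} = n - 1 := by simp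
  have hK : d ≤ (Finset.univ.filter fun i => z i = 0).card := by
    have := Finset.card_filter_add_card_filter_not (s := Finset.univ) (fun i => z i = 0)
    rw [Finset.card_univ, hc] at this
    have hb' : (Finset.univ.filter fun i => ¬ z i = 0).card ≤ n - d - 1 := by
      rw [← Fintype.card_subtype]
      convert! hb
    omega
  obtain ⟨J, hJ, hJd⟩ := Finset.exists_subset_card_eq hK
  -- In the coordinates diagonalizing `B`, the point is the projection onto `d` coordinates in the
  -- kernel of `B`.
  obtain ⟨s, hs⟩ := exists_congruenceLinear_eq hVR
    (Matrix.diagonal fun i => if i ∈ J then (1 : ℂ) else 0) (Matrix.diagonal_transpose _)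
  have hs0 : s ≠ 0 := by
    rintro rfl
    obtain ⟨j, hj⟩ := Finset.card_pos.1 (show 0 < J.card by omega)
    have := congrFun (congrFun hs j) j
    simp [hj] at this
  obtain ⟨c, hrep⟩ := Projectivization.exists_smul_eq_mk_rep ℂ s hs0
  have hx : congruenceLinear o R (Projectivization.mk ℂ s hs0).rep =
      Matrix.diagonal fun i => if i ∈ J then (c : ℂ) else 0 := by
    rw [← hrep, Units.smul_def, map_smul, hs, ← Matrix.diagonal_smul]
    congr 1
    funext i
    simp
  have hcard : Fintype.card {i // (if i ∈ J then (c : ℂ) else 0) ≠ 0} = d := by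
    rw [← hJd, ← Fintype.card_coe]
    exact Fintype.card_congr (Equiv.subtypeEquivRight fun i => by simp)
  refine ⟨_, isSmoothPoint_cayleyMenger hVR hcard hx, fun w hw => ?_⟩
  -- The trace becomes a weighted sum of diagonal entries of the tangent matrix. The weights vanish
  -- where `z` does; elsewhere the index lies outside `J` and the tangent entry is zero.
  have h1 : (gramLinear o b * gramLinear o w).trace =
      (Matrix.diagonal (fun i => z i * z i) * congruenceLinear o R w).trace := by
    rw [hS, congruenceLinear_apply, Matrix.mul_assoc, Matrix.mul_assoc, Matrix.trace_mul_comm,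
      Matrix.mul_assoc, Matrix.mul_assoc]
  rw [h1, Matrix.trace]
  refine Finset.sum_eq_zero fun i _ => ?_
  rw [Matrix.diag_apply, Matrix.diagonal_mul]
  by_cases hi : z i = 0
  · simp [hi]
  · have hiJ : i ∉ J := fun h => hi (Finset.mem_filter.1 (hJ h)).2
    rw [congruenceLinear_eq_zero_of_mem_tangentSpace hVR hcard hx hw (by simp [hiJ])
      (by simp [hiJ]), mul_zero]

theorem map_image_cayleyMenger_eq_dual (d : ℕ) (hd : 1 ≤ d) (hdn : d ≤ n - 1) (o : Fin n)
    (e : (Pairs n → ℂ) ≃ₗ[ℂ] (Pairs n → ℂ))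
    (he : ∀ s t, e s ⬝ᵥ t = (gramLinear o s * gramLinear o t).trace) :
    Projectivization.map e.toLinearMap e.injective '' cayleyMenger (n - d - 1) n =
      projectiveDual (cayleyMenger d n) := by
  apply Set.Subset.antisymm
  · rintro _ ⟨b, hb, rfl⟩
    refine subset_zariskiClosure _ ?_
    rw [mem_cayleyMenger_iff _ o] at hb
    obtain ⟨x, hx, hw⟩ := exists_smooth_tangent d hd hdn o b.rep hb
    refine ⟨x, hx, fun w hwx => ?_⟩
    obtain ⟨c, hc⟩ := Projectivization.exists_smul_eq_mk_rep ℂ (e b.rep)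
      (by simpa using b.rep_nonzero)
    have hmap : Projectivization.map e.toLinearMap e.injective b =
        Projectivization.mk ℂ (e b.rep) (by simpa using b.rep_nonzero) := by
      conv_lhs => rw [← b.mk_rep]
      rfl
    rw [hmap, ← hc, Units.smul_def, smul_dotProduct, he, hw w hwx, smul_zero]
  · intro h hh
    have hne : e.symm h.rep ≠ 0 := by simpa using h.rep_nonzero
    refine ⟨Projectivization.mk ℂ (e.symm h.rep) hne, ?_, ?_⟩
    · rintro f ⟨⟨k, hk⟩, hf⟩
      -- Equations of the Cayley-Menger variety are transported by `e.symm` to the dual space. They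
      -- vanish on the tangent hyperplanes, hence on their closure.
      obtain ⟨g, hg, hgev⟩ := exists_comp_polynomial e.symm.toLinearMap hk
      refine (vanishesAt_mk hk _ hne).2 ?_
      rw [← LinearEquiv.coe_toLinearMap, ← hgev]
      refine vanishesAt_of_mem_zariskiClosure hg ?_ hh
      rintro h' ⟨x, hx, hw⟩
      have hne' : e.symm h'.rep ≠ 0 := by simpa using h'.rep_nonzero
      rw [VanishesAt, hgev, LinearEquiv.coe_toLinearMap, ← vanishesAt_mk hk _ hne']
      have hmem : Projectivization.mk ℂ (e.symm h'.rep) hne' ∈ cayleyMenger (n - d - 1) n := by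
        rw [mk_mem_cayleyMenger_iff _ o]
        refine rank_le_of_tangent d hd o hx.1 _ hne' fun w hwx => ?_
        rw [← he, LinearEquiv.apply_symm_apply]
        exact hw w hwx
      exact vanishesAt_of_mem_zariskiClosure hk hf hmem
    · rw [Projectivization.map_mk]
      conv_rhs => rw [← h.mk_rep]
      simp

end Dual

end CayleyMenger

theorem proposition4p6 (n d : ℕ) (hd : 1 ≤ d) (hdn : d ≤ n - 1) (o : Fin n) :
    ∃ e : (CayleyMenger.Pairs n → ℂ) ≃ₗ[ℂ] (CayleyMenger.Pairs n → ℂ),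
      (∀ s t : CayleyMenger.Pairs n → ℂ,
        e s ⬝ᵥ t =
          (CayleyMenger.gramMatrix o s * CayleyMenger.gramMatrix o t).trace) ∧
      Projectivization.map e.toLinearMap e.injective '' CayleyMenger.cayleyMenger (n - d - 1) n =
        CayleyMenger.projectiveDual (CayleyMenger.cayleyMenger d n) := by
  obtain ⟨e, he⟩ := CayleyMenger.exists_tracePairing o
  exact ⟨e, he, CayleyMenger.map_image_cayleyMenger_eq_dual d hd hdn o e he⟩
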